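/- All Banach lattices are real. A Banach lattice homomorphism is a bounded linear operator that preserves the lattice operations. For a real number $\lambda>1$, a Banach lattice $P$ is called $\lambda$-projective if, whenever $Y$ is a Banach lattice, $J$ a closed ideal in $Y$ and $Q\colon Y\to Y/J$ the quotient map, for every Banach lattice homomorphism $T\colon P\to Y/J$ there is a Banach lattice homomorphism $\hat T\colon P\to Y$ such that $T=Q\circ\hat T$ and $\|\hat T\|\le\lambda\|T\|$. $P$ is called $\infty$-projective if it is $\lambda$-projective for some $\lambda>1$. Theorem 1.1. Let $X$ be an $\infty$-projective Banach lattice and let $(u_i)_{i\in\mathbb N}$ be a bounded sequence of vectors in $X$. Suppose that there exists a Banach lattice homomorphism $T\colon X\to c_0$ such that $T(u_i)=e_i$ for every $i\in\mathbb N$, where $(e_i)_{i\in\mathbb N}$ is the canonical basis of $c_0$. Then there is a subsequence $(u_{i_k})_{k\in\mathbb N}$ equivalent to the canonical basis of $\ell_1$; that is, there are constants $c,C>0$ such that for every $l\in\mathbb N$ and all $\lambda_1,\dots,\lambda_l\in\mathbb R$, $$c\sum_{k=1}^{l}|\lambda_k|\le\Big\|\sum_{k=1}^{l}\lambda_k u_{i_k}\Big\|\le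 C\sum_{k=1}^{l}|\lambda_k|.$$ -/

import Mathlib

open scoped ZeroAtInfty

universe u v

/-!
Banach lattices are real Banach spaces `X` with a lattice order that is compatible with addition
(`IsOrderedAddMonoid X`), with multiplication by nonnegative scalars (`IsOrderedModule ℝ X`) and
with the norm (`HasSolidNorm X`: `|x| ≤ |y|` implies `‖x‖ ≤ ‖y‖`).
-/

namespace BanachLattice

/-! ### Closed ideals and quotient Banach lattices -/

/-- A closed ideal of a Banach lattice: a norm closed, solid linear subspace. -/
structure ClosedIdeal (X : Type*) [NormedAddCommGroup X] [NormedSpace ℝ X] [Lattice X]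
    extends Submodule ℝ X where
  isSolid' : LatticeOrderedAddCommGroup.IsSolid carrier
  isClosed' : IsClosed carrier

section Quotient

variable {X : Type*} [NormedAddCommGroup X] [NormedSpace ℝ X] [Lattice X]

theorem ClosedIdeal.mem_of_abs_le (J : ClosedIdeal X) {x y : X} (hx : x ∈ J.toSubmodule)
    (h : |y| ≤ |x|) : y ∈ J.toSubmodule :=
  J.isSolid' hx h

/-- With this instance, Mathlib provides the quotient norm on `X ⧸ J.toSubmodule`. -/
instance (J : ClosedIdeal X) : IsClosed (J.toSubmodule : Set X) := J.isClosed'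

variable [IsOrderedAddMonoid X]

theorem ClosedIdeal.mem_of_le (J : ClosedIdeal X) {x y : X} (hx : x ∈ J.toSubmodule)
    (h0 : 0 ≤ y) (h : y ≤ x) : y ∈ J.toSubmodule :=
  J.mem_of_abs_le hx (by rwa [abs_of_nonneg h0, abs_of_nonneg (h0.trans h)])

theorem ClosedIdeal.abs_mem (J : ClosedIdeal X) {x : X} (hx : x ∈ J.toSubmodule) :
    |x| ∈ J.toSubmodule :=
  J.mem_of_abs_le hx (abs_abs x).le

theorem ClosedIdeal.sup_sub_sup_mem (J : ClosedIdeal X) {a a' b b' : X}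
    (ha : a - a' ∈ J.toSubmodule) (hb : b - b' ∈ J.toSubmodule) :
    (a ⊔ b) - (a' ⊔ b') ∈ J.toSubmodule := by
  have h1 : (a ⊔ b) - (a' ⊔ b) ∈ J.toSubmodule :=
    J.mem_of_abs_le ha (abs_sup_sub_sup_le_abs _ _ _)
  have h2 : (a' ⊔ b) - (a' ⊔ b') ∈ J.toSubmodule := by
    rw [sup_comm a' b, sup_comm a' b']
    exact J.mem_of_abs_le hb (abs_sup_sub_sup_le_abs _ _ _)
  simpa using J.toSubmodule.add_mem h1 h2

theorem ClosedIdeal.inf_sub_inf_mem (J : ClosedIdeal X) {a a' b b' : X}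
    (ha : a - a' ∈ J.toSubmodule) (hb : b - b' ∈ J.toSubmodule) :
    (a ⊓ b) - (a' ⊓ b') ∈ J.toSubmodule := by
  have h1 : (a ⊓ b) - (a' ⊓ b) ∈ J.toSubmodule :=
    J.mem_of_abs_le ha (abs_inf_sub_inf_le_abs _ _ _)
  have h2 : (a' ⊓ b) - (a' ⊓ b') ∈ J.toSubmodule := by
    rw [inf_comm a' b, inf_comm a' b']
    exact J.mem_of_abs_le hb (abs_inf_sub_inf_le_abs _ _ _)
  simpa using J.toSubmodule.add_mem h1 h2

/-- The quotient order: the positive cone of `X ⧸ J` is the image of the positive cone of `X`. -/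
instance instPartialOrderQuotient (J : ClosedIdeal X) : PartialOrder (X ⧸ J.toSubmodule) where
  le a b := ∃ x : X, 0 ≤ x ∧ J.toSubmodule.mkQ x = b - a
  le_refl a := ⟨0, le_rfl, by simp⟩
  le_trans a b c := by
    rintro ⟨x, hx, hxe⟩ ⟨y, hy, hye⟩
    exact ⟨x + y, add_nonneg hx hy, by rw [map_add, hxe, hye]; abel⟩
  le_antisymm a b := by
    rintro ⟨x, hx, hxe⟩ ⟨y, hy, hye⟩
    have h : x + y ∈ J.toSubmodule := by
      rw [← Submodule.ker_mkQ J.toSubmodule, LinearMap.mem_ker, map_add, hxe, hye]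
      abel
    have hxJ : x ∈ J.toSubmodule := J.mem_of_le h hx (le_add_of_nonneg_right hy)
    rw [← Submodule.ker_mkQ J.toSubmodule, LinearMap.mem_ker, hxe] at hxJ
    exact (sub_eq_zero.mp hxJ).symm

theorem quotient_le_iff (J : ClosedIdeal X) {a b : X ⧸ J.toSubmodule} :
    a ≤ b ↔ ∃ x : X, 0 ≤ x ∧ J.toSubmodule.mkQ x = b - a := Iff.rfl

theorem mkQ_le_mkQ (J : ClosedIdeal X) {x y : X} (h : x ≤ y) :
    J.toSubmodule.mkQ x ≤ J.toSubmodule.mkQ y :=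
  ⟨y - x, sub_nonneg.mpr h, map_sub _ _ _⟩

/-- Any class below a given one has a representative below any given representative. -/
theorem exists_rep_le (J : ClosedIdeal X) {a : X ⧸ J.toSubmodule} {y : X}
    (h : a ≤ J.toSubmodule.mkQ y) : ∃ x : X, x ≤ y ∧ J.toSubmodule.mkQ x = a := by
  obtain ⟨z, hz, hze⟩ := h
  exact ⟨y - z, sub_le_self _ hz, by rw [map_sub, hze]; abel⟩

theorem exists_le_rep (J : ClosedIdeal X) {b : X ⧸ J.toSubmodule} {x : X}
    (h : J.toSubmodule.mkQ x ≤ b) : ∃ y : X, x ≤ y ∧ J.toSubmodule.mkQ y = b := by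
  obtain ⟨z, hz, hze⟩ := h
  exact ⟨x + z, le_add_of_nonneg_right hz, by rw [map_add, hze]; abel⟩

/-- The quotient lattice: suprema and infima are computed on representatives. -/
instance instLatticeQuotient (J : ClosedIdeal X) : Lattice (X ⧸ J.toSubmodule) where
  __ := instPartialOrderQuotient J
  sup := Quotient.map₂ (· ⊔ ·) (fun _ _ ha _ _ hb =>
    J.toSubmodule.quotientRel_def.mpr (J.sup_sub_sup_mem
      (J.toSubmodule.quotientRel_def.mp ha) (J.toSubmodule.quotientRel_def.mp hb)))
  inf := Quotient.map₂ (· ⊓ ·) (fun _ _ ha _ _ hb =>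
    J.toSubmodule.quotientRel_def.mpr (J.inf_sub_inf_mem
      (J.toSubmodule.quotientRel_def.mp ha) (J.toSubmodule.quotientRel_def.mp hb)))
  le_sup_left a b := by
    induction a using Submodule.Quotient.induction_on
    induction b using Submodule.Quotient.induction_on
    exact mkQ_le_mkQ J le_sup_left
  le_sup_right a b := by
    induction a using Submodule.Quotient.induction_on
    induction b using Submodule.Quotient.induction_on
    exact mkQ_le_mkQ J le_sup_right
  sup_le a b c hac hbc := by
    obtain ⟨z, rfl⟩ := J.toSubmodule.mkQ_surjective c
    obtain ⟨x, hx, rfl⟩ := exists_rep_le J hac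
    obtain ⟨y, hy, rfl⟩ := exists_rep_le J hbc
    exact mkQ_le_mkQ J (sup_le hx hy)
  inf_le_left a b := by
    induction a using Submodule.Quotient.induction_on
    induction b using Submodule.Quotient.induction_on
    exact mkQ_le_mkQ J inf_le_left
  inf_le_right a b := by
    induction a using Submodule.Quotient.induction_on
    induction b using Submodule.Quotient.induction_on
    exact mkQ_le_mkQ J inf_le_right
  le_inf a b c hab hac := by
    obtain ⟨x, rfl⟩ := J.toSubmodule.mkQ_surjective a
    obtain ⟨y, hy, rfl⟩ := exists_le_rep J hab
    obtain ⟨z, hz, rfl⟩ := exists_le_rep J hac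
    exact mkQ_le_mkQ J (le_inf hy hz)

theorem mkQ_sup (J : ClosedIdeal X) (x y : X) :
    J.toSubmodule.mkQ (x ⊔ y) = J.toSubmodule.mkQ x ⊔ J.toSubmodule.mkQ y := rfl

theorem mkQ_inf (J : ClosedIdeal X) (x y : X) :
    J.toSubmodule.mkQ (x ⊓ y) = J.toSubmodule.mkQ x ⊓ J.toSubmodule.mkQ y := rfl

theorem mkQ_abs (J : ClosedIdeal X) (x : X) :
    J.toSubmodule.mkQ |x| = |J.toSubmodule.mkQ x| := rfl

instance instIsOrderedAddMonoidQuotient (J : ClosedIdeal X) :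
    IsOrderedAddMonoid (X ⧸ J.toSubmodule) where
  add_le_add_left a b h c := by
    obtain ⟨x, hx, hxe⟩ := h
    exact ⟨x, hx, by rw [hxe]; abel⟩

instance instIsOrderedModuleQuotient [IsOrderedModule ℝ X] (J : ClosedIdeal X) :
    IsOrderedModule ℝ (X ⧸ J.toSubmodule) where
  smul_le_smul_of_nonneg_left r hr a b h := by
    obtain ⟨x, hx, hxe⟩ := h
    exact ⟨r • x, smul_nonneg hr hx, by rw [map_smul, hxe, smul_sub]⟩
  smul_le_smul_of_nonneg_right a ha r s h := by
    obtain ⟨x, hx, hxe⟩ := ha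
    exact ⟨(s - r) • x, smul_nonneg (sub_nonneg.mpr h) hx,
      by rw [map_smul, hxe, sub_zero, sub_smul]⟩

/-- The quotient norm is a lattice norm. -/
instance instHasSolidNormQuotient [HasSolidNorm X] (J : ClosedIdeal X) :
    HasSolidNorm (X ⧸ J.toSubmodule) where
  solid a b h := by
    refine le_of_forall_pos_lt_add fun ε hε => ?_
    obtain ⟨y, hyb, hy⟩ := Submodule.Quotient.norm_mk_lt b hε
    obtain ⟨x, rfl⟩ := J.toSubmodule.mkQ_surjective a
    subst hyb
    have hw : J.toSubmodule.mkQ ((x ⊓ |y|) ⊔ -|y|) = J.toSubmodule.mkQ x := by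
      have h' : |J.toSubmodule.mkQ x| ≤ J.toSubmodule.mkQ |y| := h
      rw [mkQ_sup, mkQ_inf, map_neg, inf_eq_left.mpr ((le_abs_self _).trans h'),
        sup_eq_left.mpr (neg_le.mp ((neg_le_abs _).trans h'))]
    have habs : abs ((x ⊓ |y|) ⊔ -|y|) ≤ |y| := by
      refine abs_le'.mpr ⟨sup_le inf_le_right ?_, neg_le.mp le_sup_right⟩
      exact (neg_nonpos.mpr (abs_nonneg y)).trans (abs_nonneg y)
    rw [← hw]
    exact ((Submodule.Quotient.norm_mk_le J.toSubmodule _).trans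
      (norm_le_norm_of_abs_le_abs habs)).trans_lt hy

end Quotient

/-! ### Homomorphisms and projectivity -/

/-- A Banach lattice homomorphism is a bounded linear operator that preserves `⊔` and `⊓`. -/
def IsBanachLatticeHom {X Y : Type*} [NormedAddCommGroup X] [NormedSpace ℝ X] [Lattice X]
    [NormedAddCommGroup Y] [NormedSpace ℝ Y] [Lattice Y] (T : X →L[ℝ] Y) : Prop :=
  (∀ x y : X, T (x ⊔ y) = T x ⊔ T y) ∧ ∀ x y : X, T (x ⊓ y) = T x ⊓ T y

/-- `P` is `lam`-projective: every Banach lattice homomorphism `T` from `P` to a quotient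
`X ⧸ J` of a Banach lattice by a closed ideal lifts to a Banach lattice homomorphism
`That : P → X` with `‖That‖ ≤ lam * ‖T‖`. (The test lattices `X` range over the universe `v`, which
need not be the universe of `P`.) -/
def IsLambdaProjective (lam : ℝ) (P : Type u) [NormedAddCommGroup P] [NormedSpace ℝ P]
    [Lattice P] : Prop :=
  ∀ (X : Type v) [NormedAddCommGroup X] [NormedSpace ℝ X] [CompleteSpace X] [Lattice X]
    [IsOrderedAddMonoid X] [IsOrderedModule ℝ X] [HasSolidNorm X] (J : ClosedIdeal X)
    (T : P →L[ℝ] X ⧸ J.toSubmodule), IsBanachLatticeHom T →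
      ∃ That : P →L[ℝ] X, IsBanachLatticeHom That ∧ T = J.toSubmodule.mkQL ∘L That ∧
        ‖That‖ ≤ lam * ‖T‖

/-- `P` is `∞`-projective if it is `lam`-projective for some real `lam > 1`. -/
def IsInftyProjective (P : Type u) [NormedAddCommGroup P] [NormedSpace ℝ P]
    [Lattice P] : Prop :=
  ∃ lam : ℝ, 1 < lam ∧ IsLambdaProjective.{u, v} lam P

/-! ### The Banach lattice `c₀` -/

section ZeroAtInfty

variable {α : Type*} [TopologicalSpace α]

instance instPartialOrderC0 : PartialOrder C₀(α, ℝ) :=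
  PartialOrder.lift (fun f => (f : α → ℝ)) DFunLike.coe_injective

/-- The pointwise lattice structure on `C₀(α, ℝ)`. -/
instance instLatticeC0 : Lattice C₀(α, ℝ) where
  __ := instPartialOrderC0
  sup f g :=
    { toFun := fun a => f a ⊔ g a
      continuous_toFun := (map_continuous f).sup (map_continuous g)
      zero_at_infty' := by
        simpa using (zero_at_infty f).sup_nhds (zero_at_infty g) }
  inf f g :=
    { toFun := fun a => f a ⊓ g a
      continuous_toFun := (map_continuous f).inf (map_continuous g)
      zero_at_infty' := by
        simpa using (zero_at_infty f).inf_nhds (zero_at_infty g) }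
  le_sup_left _ _ _ := le_sup_left
  le_sup_right _ _ _ := le_sup_right
  sup_le _ _ _ h₁ h₂ a := sup_le (h₁ a) (h₂ a)
  inf_le_left _ _ _ := inf_le_left
  inf_le_right _ _ _ := inf_le_right
  le_inf _ _ _ h₁ h₂ a := le_inf (h₁ a) (h₂ a)

theorem c0_sup_apply (f g : C₀(α, ℝ)) (a : α) : (f ⊔ g) a = f a ⊔ g a := rfl

theorem c0_inf_apply (f g : C₀(α, ℝ)) (a : α) : (f ⊓ g) a = f a ⊓ g a := rfl

theorem c0_abs_apply (f : C₀(α, ℝ)) (a : α) : |f| a = |f a| := rfl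

instance instIsOrderedAddMonoidC0 : IsOrderedAddMonoid C₀(α, ℝ) where
  add_le_add_left _ _ h c a := add_le_add_left (h a) (c a)

instance instIsOrderedModuleC0 : IsOrderedModule ℝ C₀(α, ℝ) where
  smul_le_smul_of_nonneg_left _ hr _ _ h a := mul_le_mul_of_nonneg_left (h a) hr
  smul_le_smul_of_nonneg_right _ hf _ _ h a := mul_le_mul_of_nonneg_right h (hf a)

instance instHasSolidNormC0 : HasSolidNorm C₀(α, ℝ) where
  solid f g h := by
    rw [← ZeroAtInftyContinuousMap.norm_toBCF_eq_norm,
      ← ZeroAtInftyContinuousMap.norm_toBCF_eq_norm]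
    exact norm_le_norm_of_abs_le_abs (fun a => h a)

end ZeroAtInfty

/-- The `i`-th unit vector of `c₀ = C₀(ℕ, ℝ)` (sequences tending to zero, with the sup norm). -/
noncomputable def c0Unit (i : ℕ) : C₀(ℕ, ℝ) where
  toFun := Pi.single i 1
  continuous_toFun := continuous_of_discreteTopology
  zero_at_infty' := by
    rw [Filter.cocompact_eq_cofinite]
    refine tendsto_const_nhds.congr' ?_
    filter_upwards [(Set.finite_singleton i).compl_mem_cofinite] with n hn
    exact (Pi.single_eq_of_ne (M := fun _ : ℕ => ℝ) (by simpa using hn) 1).symm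

/-! ### Equivalence of sequences -/

/-- The sequences `x` and `y` are equivalent: `∑ aₖ yₖ ↦ ∑ aₖ xₖ` (finite sums) is well defined
and is an isomorphism between the linear spans for the norms of `E` and `F`. -/
def EquivalentSeq {E F : Type*} [NormedAddCommGroup E] [NormedSpace ℝ E]
    [NormedAddCommGroup F] [NormedSpace ℝ F] (x : ℕ → E) (y : ℕ → F) : Prop :=
  ∃ c C : ℝ, 0 < c ∧ 0 < C ∧ ∀ (s : Finset ℕ) (a : ℕ → ℝ),
    c * ‖∑ k ∈ s, a k • y k‖ ≤ ‖∑ k ∈ s, a k • x k‖ ∧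
      ‖∑ k ∈ s, a k • x k‖ ≤ C * ‖∑ k ∈ s, a k • y k‖

/-- The `k`-th vector of the canonical basis of `ℓ₁`. -/
noncomputable def l1Unit (k : ℕ) : lp (fun _ : ℕ => ℝ) 1 := lp.single 1 k (1 : ℝ)

end BanachLattice

/-! The upper estimate is just boundedness of the sequence. For the lower one, `c₀` is embedded in a
quotient of a test lattice whose norm is of `ℓ₁` type: functions of points `(n, F)`, with `F ⊆ c₀`
finite, normed by the supremum of their `ℓ₁`-sums over admissible finite sets of points. Each `a ∈
c₀` lifts to the function equal to `a n` where `a ∈ F` and to `0` elsewhere. The truncation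
disappears as `F` grows, so modulo functions vanishing in that limit the lift is a lattice
homomorphism (`isBanachLatticeHom_c0Embedding`).

Projectivity lifts its composition with `T` to a bounded `R` from `X` to the test lattice. The value
of `R (x i)` at `(i, F)` tends to `1`, hence is at least `1/2` for some `F i`. Since `a` is seen at
`(i, F i)` only if it lies in the finite set `F i`, a sparse choice of indices makes all finite sets
of these points admissible (`exists_strictMono_admissible`), and the norm dominates `ℓ₁`-sums over
them. The values of the `R (x i)` there form a matrix with bounded row sums and diagonal at least
`1/2`. Rosenthal's lemma (`exists_strictMono_offDiagonal_sum_le`) thins it until the diagonal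
dominates, which gives the `ℓ₁` lower bound. -/

namespace BanachLattice

open Filter Topology

/-! ### Rosenthal's disjointification lemma -/

/-- Induction on the row bound in units of `ε`. The ranges of `Nat.pair p` split `ℕ` into infinitely
many infinite blocks. If no block works, each contains a row `m p` with off-diagonal mass above `ε`
inside its own block; keeping only the indices `m p` discards that mass and lowers the row bound by
`ε`. -/
theorem exists_infinite_offDiagonal_sum_le {ε : ℝ} (hε : 0 < ε) (n : ℕ) :
    ∀ b : ℕ → ℕ → ℝ, (∀ m k, 0 ≤ b m k) →
      (∀ (m : ℕ) (s : Finset ℕ), ∑ k ∈ s, b m k ≤ n * ε) →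
      ∃ N : Set ℕ, N.Infinite ∧ ∀ m ∈ N, ∀ s : Finset ℕ, (s : Set ℕ) ⊆ N → m ∉ s →
        ∑ k ∈ s, b m k ≤ ε := by
  induction n with
  | zero =>
    intro b _ hs
    refine ⟨Set.univ, Set.infinite_univ, fun m _ s _ _ => (hs m s).trans ?_⟩
    simpa using hε.le
  | succ n ih =>
    intro b hb hs
    by_cases h : ∃ p : ℕ, ∀ m ∈ Set.range (Nat.pair p), ∀ s : Finset ℕ,
        (s : Set ℕ) ⊆ Set.range (Nat.pair p) → m ∉ s → ∑ k ∈ s, b m k ≤ ε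
    · obtain ⟨p, hp⟩ := h
      refine ⟨_, Set.infinite_range_of_injective ?_, hp⟩
      intro i j hij
      exact (Nat.pair_eq_pair.mp hij).2
    · push Not at h
      choose m hm t htm hmt htε using h
      have hfst : ∀ p, ∀ k ∈ Set.range (Nat.pair p), k.unpair.1 = p := by
        rintro p _ ⟨j, rfl⟩
        simp
      have hinj : Function.Injective m := fun p q hpq => by
        rw [← hfst p _ (hm p), hpq, hfst q _ (hm q)]
      obtain ⟨N, hN, hNs⟩ := ih (fun p q => b (m p) (m q)) (fun _ _ => hb _ _) (by
        intro p s
        -- The only retained index in block `p` is `m p`, which `t p` avoids.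
        have hdisj : Disjoint (s.map ⟨m, hinj⟩) (t p) := by
          rw [Finset.disjoint_left]
          intro k hk hkt
          obtain ⟨q, -, rfl⟩ := Finset.mem_map.mp hk
          have hq : q = p := by
            rw [← hfst q _ (hm q)]
            exact hfst p _ (htm p hkt)
          subst hq
          exact hmt q hkt
        have h1 := hs (m p) ((s.map ⟨m, hinj⟩).disjUnion (t p) hdisj)
        rw [Finset.sum_disjUnion, Finset.sum_map] at h1
        have h2 := htε p
        push_cast at h1
        simp only [Function.Embedding.coeFn_mk] at h1
        linarith)
      refine ⟨m '' N, hN.image hinj.injOn, ?_⟩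
      rintro _ ⟨p, hp, rfl⟩ s hsN hps
      obtain ⟨s', hs'N, rfl⟩ := Finset.subset_set_image_iff.mp hsN
      rw [Finset.sum_image hinj.injOn]
      exact hNs p hp s' hs'N fun h => hps (Finset.mem_image_of_mem m h)

theorem exists_strictMono_offDiagonal_sum_le {ε C : ℝ} (hε : 0 < ε) {b : ℕ → ℕ → ℝ}
    (hb : ∀ m k, 0 ≤ b m k) (hC : ∀ (m : ℕ) (s : Finset ℕ), ∑ k ∈ s, b m k ≤ C) :
    ∃ ψ : ℕ → ℕ, StrictMono ψ ∧ ∀ (m : ℕ) (s : Finset ℕ), m ∉ s →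
      ∑ k ∈ s, b (ψ m) (ψ k) ≤ ε := by
  obtain ⟨n, hn⟩ := exists_nat_ge (C / ε)
  obtain ⟨N, hN, hNs⟩ := exists_infinite_offDiagonal_sum_le hε n b hb
    fun m s => (hC m s).trans ((div_le_iff₀ hε).mp hn)
  have hmono := Nat.nth_strictMono (p := (· ∈ N)) hN
  have hmem : ∀ k, Nat.nth (· ∈ N) k ∈ N := fun k => Nat.nth_mem_of_infinite hN k
  refine ⟨_, hmono, fun m s hms => ?_⟩
  have h := hNs _ (hmem m) (s.map ⟨_, hmono.injective⟩) (by
    intro k hk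
    obtain ⟨j, -, rfl⟩ := Finset.mem_map.mp (Finset.mem_coe.mp hk)
    exact hmem j) (fun h => hms (by simpa [hmono.injective.eq_iff] using h))
  rwa [Finset.sum_map] at h

/-- A matrix whose diagonal is at least `δ` and whose off-diagonal row sums are at most `ε` is
bounded below by `δ - ε` on `ℓ₁`. -/
theorem sum_abs_le_sum_abs_sum {δ ε : ℝ} {b : ℕ → ℕ → ℝ} (s : Finset ℕ)
    (hdiag : ∀ m ∈ s, δ ≤ b m m) (hoff : ∀ m ∈ s, ∑ k ∈ s.erase m, |b m k| ≤ ε) (a : ℕ → ℝ) :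
    (δ - ε) * ∑ m ∈ s, |a m| ≤ ∑ k ∈ s, |∑ m ∈ s, a m * b m k| := by
  have h1 : ∀ k ∈ s, δ * |a k| - ∑ m ∈ s.erase k, |a m| * |b m k| ≤ |∑ m ∈ s, a m * b m k| := by
    intro k hk
    rw [← Finset.add_sum_erase s _ hk]
    have h2 : |∑ m ∈ s.erase k, a m * b m k| ≤ ∑ m ∈ s.erase k, |a m| * |b m k| := by
      simpa only [abs_mul] using Finset.abs_sum_le_sum_abs (fun m => a m * b m k) (s.erase k)
    have h3 : δ * |a k| ≤ |a k * b k k| := by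
      rw [abs_mul, mul_comm]
      exact mul_le_mul_of_nonneg_left ((hdiag k hk).trans (le_abs_self _)) (abs_nonneg _)
    have h4 := abs_sub_abs_le_abs_sub (a k * b k k) (-∑ m ∈ s.erase k, a m * b m k)
    rw [abs_neg, sub_neg_eq_add] at h4
    linarith
  have h5 : ∑ k ∈ s, ∑ m ∈ s.erase k, |a m| * |b m k| ≤ ε * ∑ m ∈ s, |a m| := by
    -- The errors arise column by column, while `hoff` controls rows.
    have hswap : ∑ k ∈ s, ∑ m ∈ s.erase k, |a m| * |b m k|
        = ∑ m ∈ s, ∑ k ∈ s.erase m, |a m| * |b m k| := by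
      refine Finset.sum_comm' fun k m => ?_
      simp only [Finset.mem_erase]
      tauto
    rw [hswap, Finset.mul_sum]
    refine Finset.sum_le_sum fun m hm => ?_
    rw [← Finset.mul_sum, mul_comm]
    exact mul_le_mul_of_nonneg_right (hoff m hm) (abs_nonneg _)
  have h6 := Finset.sum_le_sum h1
  rw [Finset.sum_sub_distrib, ← Finset.mul_sum] at h6
  linarith

/-! ### The Banach lattice of a covering family of finite sets -/

section FamilySpace

variable {D : Type*}

/-- The real functions on `D` whose `ℓ₁`-norms over the members of `𝒢` are uniformly bounded. -/
def familySpace (𝒢 : Set (Finset D)) : Submodule ℝ (D → ℝ) where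
  carrier := {f | ∃ C : ℝ, ∀ G ∈ 𝒢, ∑ d ∈ G, |f d| ≤ C}
  zero_mem' := ⟨0, fun G _ => by simp⟩
  add_mem' := by
    rintro f g ⟨C, hC⟩ ⟨C', hC'⟩
    refine ⟨C + C', fun G hG => ?_⟩
    refine le_trans ?_ (add_le_add (hC G hG) (hC' G hG))
    rw [← Finset.sum_add_distrib]
    exact Finset.sum_le_sum fun d _ => abs_add_le _ _
  smul_mem' := by
    rintro r f ⟨C, hC⟩
    refine ⟨|r| * C, fun G hG => ?_⟩
    simp only [Pi.smul_apply, smul_eq_mul, abs_mul, ← Finset.mul_sum]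
    exact mul_le_mul_of_nonneg_left (hC G hG) (abs_nonneg r)

variable {𝒢 : Set (Finset D)}

theorem familySpace_mem_of_abs_le {f g : D → ℝ} (hg : g ∈ familySpace 𝒢)
    (h : ∀ d, |f d| ≤ |g d|) : f ∈ familySpace 𝒢 := by
  obtain ⟨C, hC⟩ := hg
  exact ⟨C, fun G hG => (Finset.sum_le_sum fun d _ => h d).trans (hC G hG)⟩

theorem familySpace_abs_mem {f : D → ℝ} (hf : f ∈ familySpace 𝒢) : |f| ∈ familySpace 𝒢 :=
  familySpace_mem_of_abs_le hf fun d => by simp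

theorem familySpace_sup_mem {f g : D → ℝ} (hf : f ∈ familySpace 𝒢) (hg : g ∈ familySpace 𝒢) :
    f ⊔ g ∈ familySpace 𝒢 := by
  refine familySpace_mem_of_abs_le
    ((familySpace 𝒢).add_mem (familySpace_abs_mem hf) (familySpace_abs_mem hg)) fun d => ?_
  have h : |(|f| + |g|) d| = |f d| + |g d| :=
    abs_of_nonneg (add_nonneg (abs_nonneg (f d)) (abs_nonneg (g d)))
  rw [h]
  exact abs_max_le_max_abs_abs.trans (max_le_add_of_nonneg (abs_nonneg _) (abs_nonneg _))

theorem familySpace_inf_mem {f g : D → ℝ} (hf : f ∈ familySpace 𝒢) (hg : g ∈ familySpace 𝒢) :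
    f ⊓ g ∈ familySpace 𝒢 := by
  have h := (familySpace 𝒢).neg_mem (familySpace_sup_mem
    ((familySpace 𝒢).neg_mem hf) ((familySpace 𝒢).neg_mem hg))
  rwa [neg_sup, neg_neg, neg_neg] at h

/-- The Banach lattice of the functions whose `ℓ₁`-norms over the members of `𝒢` are bounded. A
type synonym of `familySpace 𝒢`, which carries the topology of pointwise convergence. -/
def FamilySpace (𝒢 : Set (Finset D)) : Type _ := familySpace 𝒢

instance : AddCommGroup (FamilySpace 𝒢) := inferInstanceAs (AddCommGroup (familySpace 𝒢))

instance : Module ℝ (FamilySpace 𝒢) := inferInstanceAs (Module ℝ (familySpace 𝒢))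

instance : PartialOrder (FamilySpace 𝒢) := inferInstanceAs (PartialOrder (familySpace 𝒢))

instance instLatticeFamilySpace : Lattice (FamilySpace 𝒢) where
  sup f g := ⟨f.1 ⊔ g.1, familySpace_sup_mem f.2 g.2⟩
  inf f g := ⟨f.1 ⊓ g.1, familySpace_inf_mem f.2 g.2⟩
  le_sup_left f g := le_sup_left (a := f.1) (b := g.1)
  le_sup_right f g := le_sup_right (a := f.1) (b := g.1)
  sup_le f g h := sup_le (a := f.1) (b := g.1) (c := h.1)
  inf_le_left f g := inf_le_left (a := f.1) (b := g.1)
  inf_le_right f g := inf_le_right (a := f.1) (b := g.1)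
  le_inf _ _ _ h h' := fun d => le_inf (h d) (h' d)

theorem familySpace_sum_smul_apply (s : Finset ℕ) (a : ℕ → ℝ) (f : ℕ → FamilySpace 𝒢) (d : D) :
    (∑ k ∈ s, a k • f k).1 d = ∑ k ∈ s, a k * (f k).1 d :=
  map_sum ((LinearMap.proj d).comp (familySpace 𝒢).subtype) (fun k => a k • f k) s

instance instIsOrderedAddMonoidFamilySpace : IsOrderedAddMonoid (FamilySpace 𝒢) where
  add_le_add_left _ _ h c d := add_le_add_left (h d) (c.1 d)

instance instIsOrderedModuleFamilySpace : IsOrderedModule ℝ (FamilySpace 𝒢) where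
  smul_le_smul_of_nonneg_left _ hr _ _ h d := mul_le_mul_of_nonneg_left (h d) hr
  smul_le_smul_of_nonneg_right _ hf _ _ h d := mul_le_mul_of_nonneg_right h (hf d)

noncomputable instance instNormFamilySpace : Norm (FamilySpace 𝒢) where
  norm f := ⨆ G : 𝒢, ∑ d ∈ G.1, |f.1 d|

theorem familySpace_sum_le_norm (f : FamilySpace 𝒢) {G : Finset D} (hG : G ∈ 𝒢) :
    ∑ d ∈ G, |f.1 d| ≤ ‖f‖ := by
  obtain ⟨C, hC⟩ := f.2
  refine le_ciSup (f := fun G : 𝒢 => ∑ d ∈ G.1, |f.1 d|) ⟨C, ?_⟩ ⟨G, hG⟩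
  rintro _ ⟨G, rfl⟩
  exact hC G.1 G.2

theorem familySpace_norm_le (f : FamilySpace 𝒢) {C : ℝ} (hC : 0 ≤ C)
    (h : ∀ G ∈ 𝒢, ∑ d ∈ G, |f.1 d| ≤ C) : ‖f‖ ≤ C :=
  Real.iSup_le (fun G => h G.1 G.2) hC

theorem familySpace_norm_nonneg (f : FamilySpace 𝒢) : 0 ≤ ‖f‖ :=
  Real.iSup_nonneg fun _ => Finset.sum_nonneg fun _ _ => abs_nonneg _

variable [hcov : Fact (∀ d : D, {d} ∈ 𝒢)]

/-- The singletons in `𝒢` make evaluations contractive; definiteness of the norm, completeness and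
closedness of the vanishing ideals rest on this. -/
theorem familySpace_abs_apply_le_norm (f : FamilySpace 𝒢) (d : D) : |f.1 d| ≤ ‖f‖ := by
  simpa using familySpace_sum_le_norm f (hcov.out d)

theorem familySpace_core : NormedSpace.Core ℝ (FamilySpace 𝒢) where
  norm_nonneg := familySpace_norm_nonneg
  norm_smul r f := by
    rw [Real.norm_eq_abs]
    refine Eq.trans (iSup_congr fun G => ?_) (Real.mul_iSup_of_nonneg (abs_nonneg r) _).symm
    rw [Finset.mul_sum]
    exact Finset.sum_congr rfl fun d _ => abs_mul r (f.1 d)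
  norm_triangle f g := by
    refine familySpace_norm_le _
      (add_nonneg (familySpace_norm_nonneg f) (familySpace_norm_nonneg g)) fun G hG => ?_
    refine le_trans ?_ (add_le_add (familySpace_sum_le_norm f hG) (familySpace_sum_le_norm g hG))
    rw [← Finset.sum_add_distrib]
    exact Finset.sum_le_sum fun d _ => abs_add_le _ _
  norm_eq_zero_iff f := by
    constructor
    · intro h
      refine Subtype.ext (funext fun d => ?_)
      exact abs_nonpos_iff.mp ((familySpace_abs_apply_le_norm f d).trans h.le)
    · rintro rfl
      exact le_antisymm (familySpace_norm_le _ le_rfl fun G _ =>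
        (Finset.sum_eq_zero fun _ _ => abs_zero).le)
        (familySpace_norm_nonneg _)

noncomputable instance instNormedAddCommGroupFamilySpace : NormedAddCommGroup (FamilySpace 𝒢) :=
  NormedAddCommGroup.ofCore familySpace_core

noncomputable instance instNormedSpaceFamilySpace : NormedSpace ℝ (FamilySpace 𝒢) :=
  NormedSpace.ofCore familySpace_core

instance instHasSolidNormFamilySpace : HasSolidNorm (FamilySpace 𝒢) where
  solid f g h := familySpace_norm_le f (familySpace_norm_nonneg g) fun _ hG =>
    (Finset.sum_le_sum fun d _ => h d).trans (familySpace_sum_le_norm g hG)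

instance instCompleteSpaceFamilySpace : CompleteSpace (FamilySpace 𝒢) := by
  refine Metric.complete_of_cauchySeq_tendsto fun u hu => ?_
  have hpt : ∀ d, ∃ y, Tendsto (fun n => (u n).1 d) atTop (𝓝 y) := fun d => by
    refine cauchySeq_tendsto_of_complete (Metric.cauchySeq_iff.mpr fun ε hε => ?_)
    obtain ⟨N, hN⟩ := Metric.cauchySeq_iff.mp hu ε hε
    refine ⟨N, fun m hm n hn => lt_of_le_of_lt ?_ (hN m hm n hn)⟩
    exact (familySpace_abs_apply_le_norm (u m - u n) d).trans (dist_eq_norm (u m) (u n)).ge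
  choose g hg using hpt
  -- Each `G` is finite, so the Cauchy estimate survives the pointwise limit, with `N` independent
  -- of `G`.
  have key : ∀ ε > 0, ∃ N, ∀ n ≥ N, ∀ G ∈ 𝒢, ∑ d ∈ G, |(u n).1 d - g d| ≤ ε := by
    intro ε hε
    obtain ⟨N, hN⟩ := Metric.cauchySeq_iff.mp hu ε hε
    refine ⟨N, fun n hn G hG => ?_⟩
    refine le_of_tendsto (tendsto_finsetSum G fun d _ => (tendsto_const_nhds.sub (hg d)).abs) ?_
    filter_upwards [eventually_ge_atTop N] with m hm
    have h := (hN n hn m hm).le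
    rw [dist_eq_norm] at h
    exact (familySpace_sum_le_norm (u n - u m) hG).trans h
  have hmem : g ∈ familySpace 𝒢 := by
    obtain ⟨N, hN⟩ := key 1 one_pos
    have h : (u N).1 - g ∈ familySpace 𝒢 := ⟨1, hN N le_rfl⟩
    simpa using (familySpace 𝒢).sub_mem (u N).2 h
  let g' : FamilySpace 𝒢 := ⟨g, hmem⟩
  refine ⟨g', Metric.tendsto_atTop.mpr fun ε hε => ?_⟩
  obtain ⟨N, hN⟩ := key (ε / 2) (half_pos hε)
  refine ⟨N, fun n hn => lt_of_le_of_lt ?_ (half_lt_self hε)⟩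
  rw [dist_eq_norm]
  exact familySpace_norm_le _ (half_pos hε).le (hN n hn)

/-- The closed ideal of the functions tending to zero along each of the given filters. -/
def vanishingIdeal {ι : Type*} (l : ι → Filter D) : ClosedIdeal (FamilySpace 𝒢) where
  carrier := {f | ∀ i, Tendsto f.1 (l i) (𝓝 0)}
  zero_mem' _ := tendsto_const_nhds
  add_mem' hf hg i := (add_zero (0 : ℝ)) ▸ (hf i).add (hg i)
  smul_mem' r f hf i := (mul_zero r) ▸ (hf i).const_mul r
  isSolid' f hf g hgf i :=
    squeeze_zero_norm (fun d => hgf d) (abs_zero (α := ℝ) ▸ (hf i).abs)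
  isClosed' := by
    refine isClosed_of_closure_subset fun f hf i => ?_
    rw [Metric.tendsto_nhds]
    intro ε hε
    obtain ⟨g, hg, hfg⟩ := Metric.mem_closure_iff.mp hf (ε / 2) (half_pos hε)
    filter_upwards [Metric.tendsto_nhds.mp (hg i) (ε / 2) (half_pos hε)] with d hd
    rw [dist_eq_norm] at hfg
    have h1 : |f.1 d - g.1 d| < ε / 2 :=
      (familySpace_abs_apply_le_norm (f - g) d).trans_lt hfg
    rw [Real.dist_eq, sub_zero] at hd ⊢
    have h2 := abs_add_le (f.1 d - g.1 d) (g.1 d)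
    rw [sub_add_cancel] at h2
    linarith

theorem mem_vanishingIdeal {ι : Type*} {l : ι → Filter D} {f : FamilySpace 𝒢} :
    f ∈ (vanishingIdeal l).toSubmodule ↔ ∀ i, Tendsto f.1 (l i) (𝓝 0) := Iff.rfl

end FamilySpace

/-! ### A lattice copy of `c₀` in a quotient -/

/-- The points on which the test lattice lives: `(n, F)` stands for the evaluation at `n`, truncated
to the finite set `F ⊆ c₀`. -/
abbrev TruncatedPoint : Type v := ULift.{v} (ℕ × Finset C₀(ℕ, ℝ))

theorem c0_abs_apply_le_norm (a : C₀(ℕ, ℝ)) (n : ℕ) : |a n| ≤ ‖a‖ := by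
  rw [← ZeroAtInftyContinuousMap.norm_toBCF_eq_norm]
  exact a.toBCF.norm_coe_le_norm n

open Classical in
/-- The element of `c₀` evaluated at a truncated point. -/
noncomputable def truncatedEval (a : C₀(ℕ, ℝ)) (d : TruncatedPoint.{v}) : ℝ :=
  if a ∈ d.down.2 then a d.down.1 else 0

/-- The finite sets over which every `a ∈ c₀` has truncated `ℓ₁`-norm at most `3 * ‖a‖`. -/
def admissible : Set (Finset TruncatedPoint.{v}) :=
  {G | ∀ a : C₀(ℕ, ℝ), ∑ d ∈ G, |truncatedEval a d| ≤ 3 * ‖a‖}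

theorem abs_truncatedEval_le (a : C₀(ℕ, ℝ)) (d : TruncatedPoint.{v}) :
    |truncatedEval a d| ≤ ‖a‖ := by
  unfold truncatedEval
  split_ifs
  · exact c0_abs_apply_le_norm _ _
  · simp

instance instFactAdmissible : Fact (∀ d : TruncatedPoint.{v}, {d} ∈ admissible.{v}) :=
  ⟨fun d a => by
    have := abs_truncatedEval_le a d
    have := norm_nonneg a
    rw [Finset.sum_singleton]
    linarith⟩

/-- The element of the test lattice lifting `a ∈ c₀`. -/
noncomputable def c0Lift (a : C₀(ℕ, ℝ)) : FamilySpace admissible.{v} :=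
  ⟨truncatedEval a, 3 * ‖a‖, fun _ hG => hG a⟩

theorem norm_c0Lift_le (a : C₀(ℕ, ℝ)) : ‖c0Lift.{v} a‖ ≤ 3 * ‖a‖ :=
  familySpace_norm_le _ (by positivity) fun _ hG => hG a

/-- The filter on truncated points at `n` along growing finite sets. -/
def pointFilter (n : ℕ) : Filter TruncatedPoint.{v} :=
  Filter.map (fun F => ⟨(n, F)⟩) atTop

theorem eventually_truncatedEval (a : C₀(ℕ, ℝ)) (n : ℕ) :
    ∀ᶠ d in pointFilter.{v} n, truncatedEval a d = a n := by
  rw [pointFilter, eventually_map]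
  filter_upwards [eventually_ge_atTop {a}] with F hF
  exact if_pos (hF (Finset.mem_singleton_self a))

/-- `c0Lift` need not respect sums or suprema, because membership in `F` is tested separately for
each element. The identities hold once `F` contains all elements involved, and that suffices in the
quotient. -/
theorem mkQ_eq_mkQ_of_eventuallyEq {f g : FamilySpace admissible.{v}}
    (h : ∀ n, ∀ᶠ d in pointFilter.{v} n, f.1 d = g.1 d) :
    (vanishingIdeal pointFilter.{v}).toSubmodule.mkQ f =
      (vanishingIdeal pointFilter.{v}).toSubmodule.mkQ g := by
  rw [← sub_eq_zero, ← map_sub, ← LinearMap.mem_ker, Submodule.ker_mkQ, mem_vanishingIdeal]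
  intro n
  refine tendsto_const_nhds.congr' ?_
  filter_upwards [h n] with d hd
  exact (sub_eq_zero.mpr hd).symm

/-- The canonical embedding of `c₀` in the quotient of the test lattice. -/
noncomputable def c0Embedding : C₀(ℕ, ℝ) →L[ℝ]
    (FamilySpace admissible.{v}) ⧸ (vanishingIdeal pointFilter.{v}).toSubmodule :=
  LinearMap.mkContinuous
    { toFun := fun a => (vanishingIdeal pointFilter.{v}).toSubmodule.mkQ (c0Lift a)
      map_add' := fun a b => by
        rw [← map_add]
        refine mkQ_eq_mkQ_of_eventuallyEq fun n => ?_
        filter_upwards [eventually_truncatedEval a n, eventually_truncatedEval b n,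
          eventually_truncatedEval (a + b) n] with d ha hb hab
        change truncatedEval (a + b) d = truncatedEval a d + truncatedEval b d
        rw [ha, hb, hab, ZeroAtInftyContinuousMap.add_apply]
      map_smul' := fun r a => by
        rw [← map_smul]
        refine mkQ_eq_mkQ_of_eventuallyEq fun n => ?_
        filter_upwards [eventually_truncatedEval a n,
          eventually_truncatedEval (r • a) n] with d ha hra
        change truncatedEval (r • a) d = r • truncatedEval a d
        rw [ha, hra, ZeroAtInftyContinuousMap.smul_apply] }
    3 fun a => (Submodule.Quotient.norm_mk_le _ _).trans (norm_c0Lift_le a)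

theorem c0Embedding_apply (a : C₀(ℕ, ℝ)) :
    c0Embedding.{v} a = (vanishingIdeal pointFilter.{v}).toSubmodule.mkQ (c0Lift a) := rfl

theorem isBanachLatticeHom_c0Embedding : IsBanachLatticeHom c0Embedding.{v} := by
  constructor
  · intro a b
    simp only [c0Embedding_apply]
    rw [← mkQ_sup]
    refine mkQ_eq_mkQ_of_eventuallyEq fun n => ?_
    filter_upwards [eventually_truncatedEval a n, eventually_truncatedEval b n,
      eventually_truncatedEval (a ⊔ b) n] with d ha hb hab
    change truncatedEval (a ⊔ b) d = truncatedEval a d ⊔ truncatedEval b d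
    rw [ha, hb, hab, c0_sup_apply]
  · intro a b
    simp only [c0Embedding_apply]
    rw [← mkQ_inf]
    refine mkQ_eq_mkQ_of_eventuallyEq fun n => ?_
    filter_upwards [eventually_truncatedEval a n, eventually_truncatedEval b n,
      eventually_truncatedEval (a ⊓ b) n] with d ha hb hab
    change truncatedEval (a ⊓ b) d = truncatedEval a d ⊓ truncatedEval b d
    rw [ha, hb, hab, c0_inf_apply]

theorem tendsto_of_mkQ_eq_c0Embedding {f : FamilySpace admissible.{v}} {a : C₀(ℕ, ℝ)}
    (h : (vanishingIdeal pointFilter.{v}).toSubmodule.mkQ f = c0Embedding.{v} a) (n : ℕ) :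
    Tendsto (fun F => f.1 ⟨(n, F)⟩) atTop (𝓝 (a n)) := by
  rw [c0Embedding_apply, ← sub_eq_zero, ← map_sub, ← LinearMap.mem_ker, Submodule.ker_mkQ,
    mem_vanishingIdeal] at h
  have h1 : Tendsto f.1 (pointFilter.{v} n) (𝓝 (0 + a n)) := by
    refine Tendsto.congr' ?_ ((h n).add_const (a n))
    filter_upwards [eventually_truncatedEval a n] with d hd
    change f.1 d - truncatedEval a d + a n = f.1 d
    rw [hd, sub_add_cancel]
  rw [zero_add, pointFilter, tendsto_map'_iff] at h1
  exact h1

/-! ### Admissible subsequences -/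

theorem c0_eventually_abs_apply_le (a : C₀(ℕ, ℝ)) {ε : ℝ} (hε : 0 < ε) :
    ∀ᶠ n in atTop, |a n| ≤ ε * ‖a‖ := by
  rcases eq_or_ne a 0 with rfl | ha
  · simp
  · have h := zero_at_infty a
    rw [cocompact_eq_atTop] at h
    filter_upwards [Metric.tendsto_nhds.mp h (ε * ‖a‖) (mul_pos hε (norm_pos_iff.mpr ha))]
      with n hn
    rw [Real.dist_eq, sub_zero] at hn
    exact hn.le

/-- The indices are chosen so sparse that every `a` in an earlier set `F (φ j)` has size at most
`2⁻ᵏ ‖a‖` at `φ k`. A given `a` contributes nothing before the first set containing it, at most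
`‖a‖` there, and a geometric tail of at most `2 * ‖a‖` afterwards: hence the constant `3` in
`admissible`. -/
theorem exists_strictMono_admissible (F : ℕ → Finset C₀(ℕ, ℝ)) :
    ∃ φ : ℕ → ℕ, ∃ hφ : StrictMono φ, ∀ s : Finset ℕ,
      s.map ⟨fun k => (⟨(φ k, F (φ k))⟩ : TruncatedPoint.{v}),
        fun _ _ h => hφ.injective (congrArg (fun d => d.down.1) h)⟩ ∈ admissible.{v} := by
  -- Only finitely many `a` lie in the sets `F i` with `i ≤ N`, so one index works for all of them.
  have hstep : ∀ N : ℕ, ∃ n, N < n ∧ ∀ i ≤ N, ∀ a ∈ F i, |a n| ≤ (1 / 2) ^ (N + 1) * ‖a‖ := by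
    intro N
    have h : ∀ᶠ n in atTop, ∀ i ∈ Finset.range (N + 1), ∀ a ∈ F i,
        |a n| ≤ (1 / 2) ^ (N + 1) * ‖a‖ :=
      (eventually_all_finset _).mpr fun i _ => (eventually_all_finset _).mpr fun a _ =>
        c0_eventually_abs_apply_le a (by positivity)
    obtain ⟨n, hn, hn'⟩ := ((eventually_gt_atTop N).and h).exists
    exact ⟨n, hn, fun i hi => hn' i (Finset.mem_range_succ_iff.mpr hi)⟩
  choose g hg hga using hstep
  set φ : ℕ → ℕ := fun k => g^[k] 0 with hφdef
  have hsucc : ∀ k, φ (k + 1) = g (φ k) := fun k => Function.iterate_succ_apply' g k 0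
  have hφ : StrictMono φ := strictMono_nat_of_lt_succ fun k => by
    rw [hsucc]
    exact hg _
  have hsmall : ∀ j k, j < k → ∀ a ∈ F (φ j), |a (φ k)| ≤ (1 / 2) ^ k * ‖a‖ := by
    intro j k hjk a ha
    obtain ⟨k, rfl⟩ := Nat.exists_eq_succ_of_ne_zero (Nat.ne_zero_of_lt hjk)
    rw [Nat.succ_eq_add_one, hsucc]
    refine (hga _ _ (hφ.monotone (Nat.lt_succ_iff.mp hjk)) a ha).trans ?_
    refine mul_le_mul_of_nonneg_right ?_ (norm_nonneg a)
    exact pow_le_pow_of_le_one (by norm_num) (by norm_num) (Nat.succ_le_succ (hφ.id_le k))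
  refine ⟨φ, hφ, fun s a => ?_⟩
  rw [Finset.sum_map]
  change ∑ k ∈ s, |truncatedEval a (⟨(φ k, F (φ k))⟩ : TruncatedPoint.{v})| ≤ 3 * ‖a‖
  have hgeom : ∀ t : Finset ℕ, ∑ k ∈ t, (1 / 2 : ℝ) ^ k * ‖a‖ ≤ 2 * ‖a‖ := fun t => by
    rw [← Finset.sum_mul]
    refine mul_le_mul_of_nonneg_right ?_ (norm_nonneg a)
    exact (summable_geometric_two.sum_le_tsum t fun _ _ => by positivity).trans_eq
      tsum_geometric_two
  by_cases hex : ∃ k, a ∈ F (φ k)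
  · classical
    have hbound : ∀ k, k ≠ Nat.find hex →
        |truncatedEval a (⟨(φ k, F (φ k))⟩ : TruncatedPoint.{v})| ≤ (1 / 2) ^ k * ‖a‖ := by
      intro k hk
      by_cases hak : a ∈ F (φ k)
      · have hlt : Nat.find hex < k := lt_of_le_of_ne (Nat.find_min' hex hak) (Ne.symm hk)
        simpa [truncatedEval, hak] using hsmall _ _ hlt a (Nat.find_spec hex)
      · simp [truncatedEval, hak]
    have hle : ∀ k ∈ s, |truncatedEval a (⟨(φ k, F (φ k))⟩ : TruncatedPoint.{v})| ≤
        (1 / 2) ^ k * ‖a‖ + if k = Nat.find hex then ‖a‖ else 0 := by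
      intro k _
      split_ifs with hk
      · have := abs_truncatedEval_le a (⟨(φ k, F (φ k))⟩ : TruncatedPoint.{v})
        have : 0 ≤ (1 / 2 : ℝ) ^ k * ‖a‖ := by positivity
        linarith
      · rw [add_zero]
        exact hbound k hk
    refine (Finset.sum_le_sum hle).trans ?_
    rw [Finset.sum_add_distrib, Finset.sum_ite_eq']
    have h1 := hgeom s
    have h2 : (if Nat.find hex ∈ s then ‖a‖ else 0) ≤ ‖a‖ := by
      split_ifs
      exacts [le_rfl, norm_nonneg a]
    linarith
  · push Not at hex
    rw [Finset.sum_eq_zero fun k _ => by simp [truncatedEval, hex k]]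
    positivity

/-! ### `ℓ₁`-sequences -/

theorem norm_sum_smul_l1Unit (s : Finset ℕ) (a : ℕ → ℝ) :
    ‖∑ k ∈ s, a k • l1Unit k‖ = ∑ k ∈ s, |a k| := by
  have h := lp.norm_sum_single (E := fun _ : ℕ => ℝ) (p := 1) (by simp) a s
  simp only [ENNReal.toReal_one, Real.rpow_one, Real.norm_eq_abs] at h
  rw [← h]
  congr 1
  refine Finset.sum_congr rfl fun k _ => ?_
  rw [l1Unit, ← lp.single_smul, smul_eq_mul, mul_one]

/-- A bounded sequence in the test lattice with limit `1` at the diagonal points has a subsequence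
that dominates the basis of `ℓ₁`. -/
theorem exists_strictMono_l1_lower_bound {f : ℕ → FamilySpace admissible.{v}} {M : ℝ}
    (hM : ∀ i, ‖f i‖ ≤ M) (hf : ∀ i, Tendsto (fun F => (f i).1 ⟨(i, F)⟩) atTop (𝓝 1)) :
    ∃ φ : ℕ → ℕ, StrictMono φ ∧ ∀ (s : Finset ℕ) (a : ℕ → ℝ),
      1 / 4 * ∑ k ∈ s, |a k| ≤ ‖∑ k ∈ s, a k • f (φ k)‖ := by
  have hF : ∀ i, ∃ F, 1 / 2 ≤ (f i).1 ⟨(i, F)⟩ := fun i =>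
    ((hf i).eventually_const_le (by norm_num)).exists
  choose F hF using hF
  obtain ⟨φ, hφ, hadm⟩ := exists_strictMono_admissible.{v} F
  set d : ℕ → TruncatedPoint.{v} := fun k => ⟨(φ k, F (φ k))⟩
  have hsum : ∀ (g : FamilySpace admissible.{v}) (s : Finset ℕ),
      ∑ k ∈ s, |g.1 (d k)| ≤ ‖g‖ := fun g s => by
    have h := familySpace_sum_le_norm g (hadm s)
    rwa [Finset.sum_map] at h
  -- Off-diagonal mass `1/4` against a diagonal of at least `1/2` leaves the constant `1/4`.
  obtain ⟨ψ, hψ, hoff⟩ := exists_strictMono_offDiagonal_sum_le (ε := 1 / 4) (by norm_num)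
    (b := fun m k => |(f (φ m)).1 (d k)|) (fun _ _ => abs_nonneg _)
    (fun m s => (hsum (f (φ m)) s).trans (hM _))
  refine ⟨φ ∘ ψ, hφ.comp hψ, fun s a => ?_⟩
  have h1 := sum_abs_le_sum_abs_sum (δ := 1 / 2) (ε := 1 / 4)
    (b := fun m k => (f (φ (ψ m))).1 (d (ψ k))) s (fun m _ => hF _)
    (fun m _ => hoff m _ (Finset.notMem_erase m s)) a
  have h2 := hsum (∑ k ∈ s, a k • f (φ (ψ k))) (s.map ⟨ψ, hψ.injective⟩)
  rw [Finset.sum_map] at h2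
  simp only [Function.Embedding.coeFn_mk, familySpace_sum_smul_apply] at h2
  have h3 := h1.trans h2
  norm_num at h3 ⊢
  exact h3

end BanachLattice

theorem theorem1p1 {X : Type u} [NormedAddCommGroup X] [NormedSpace ℝ X] [CompleteSpace X]
    [Lattice X] [IsOrderedAddMonoid X] [IsOrderedModule ℝ X] [HasSolidNorm X]
    (hX : BanachLattice.IsInftyProjective.{u, v} X)
    (x : ℕ → X) (hx : ∃ M : ℝ, ∀ i, ‖x i‖ ≤ M)
    (hT : ∃ T : X →L[ℝ] C₀(ℕ, ℝ), BanachLattice.IsBanachLatticeHom T ∧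
      ∀ i, T (x i) = BanachLattice.c0Unit i) :
    ∃ φ : ℕ → ℕ, StrictMono φ ∧
      BanachLattice.EquivalentSeq (fun k => x (φ k)) BanachLattice.l1Unit := by
  obtain ⟨lam, -, hX⟩ := hX
  obtain ⟨M, hM⟩ := hx
  obtain ⟨T, ⟨hTsup, hTinf⟩, hTx⟩ := hT
  obtain ⟨hSsup, hSinf⟩ := BanachLattice.isBanachLatticeHom_c0Embedding.{v}
  obtain ⟨R, -, hR, -⟩ := hX _ _ (BanachLattice.c0Embedding.{v} ∘L T)
    ⟨fun y z => by simp only [ContinuousLinearMap.comp_apply, hTsup, hSsup],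
      fun y z => by simp only [ContinuousLinearMap.comp_apply, hTinf, hSinf]⟩
  obtain ⟨φ, hφ, hlow⟩ := BanachLattice.exists_strictMono_l1_lower_bound.{v}
    (f := fun i => R (x i)) (M := ‖R‖ * M)
    (fun i => (R.le_opNorm _).trans (mul_le_mul_of_nonneg_left (hM i) (norm_nonneg _)))
    (fun i => by
      have h := DFunLike.congr_fun hR (x i)
      rw [ContinuousLinearMap.comp_apply, hTx] at h
      have h1 := BanachLattice.tendsto_of_mkQ_eq_c0Embedding h.symm i
      rwa [show BanachLattice.c0Unit i i = 1 from Pi.single_eq_same i 1] at h1)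
  -- The bounds needed are `‖R‖` and `M`; `‖R‖ + 1` and `max M 1` keep the constants positive.
  refine ⟨φ, hφ, 1 / 4 / (‖R‖ + 1), max M 1, by positivity, by positivity, fun s a => ?_⟩
  rw [BanachLattice.norm_sum_smul_l1Unit]
  constructor
  · rw [div_mul_eq_mul_div, div_le_iff₀ (by positivity)]
    refine (hlow s a).trans ?_
    simp only [← map_smul, ← map_sum]
    refine (R.le_opNorm _).trans ?_
    rw [mul_comm]
    exact mul_le_mul_of_nonneg_left (by linarith) (norm_nonneg _)
  · refine (norm_sum_le _ _).trans ?_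
    rw [Finset.mul_sum]
    refine Finset.sum_le_sum fun k _ => ?_
    rw [norm_smul, Real.norm_eq_abs, mul_comm]
    exact mul_le_mul_of_nonneg_right ((hM _).trans (le_max_left _ _)) (abs_nonneg _)
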